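/- For $n\ge 0$ let $\pi$ be a uniformly random permutation in the symmetric group $S_n$, and let $I_n=\#\{(i,j): 1\le i<j\le n,\ \pi(j)<\pi(i)\}$ be its number of inversions. Put $\sigma_n^2=\dfrac{n(2n+5)(n-1)}{72}$. (a) For every $n$ there are independent random variables $J_1,\dots,J_n$ on $S_n$ (with the uniform probability measure) such that $I_n=J_1+\cdots+J_n$ and $J_i$ is uniformly distributed on $\{0,1,\dots,i-1\}$ for $1\le i\le n$. (b) For every $n$, $\mathbf E(I_n)=\frac12\binom n2$ and $\operatorname{Var}(I_n)=\sigma_n^2$. (c) As $n\to\infty$, the random variables $\bigl(I_n-\frac12\binom n2\bigr)/\sigma_n$ converge in distribution to the standard normal distribution. (d) There is a constant $C$ such that for all $n\ge 2$ $$\sup_{x\in\mathbb R}\left|\mathbf P\!\left(\frac{I_n-\frac12\binom n2}{\sigma_n}\le x\right)-\Phi(x)\right|\le \frac{C}{\sqrt n},$$ where $\Phi$ is the standard normal distribution function. -/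

import Mathlib

open MeasureTheory ProbabilityTheory Filter

/-- The symmetric group `S_n` as a discrete measurable space: every set of permutations is
an event. -/
instance permMeasurableSpace (n : ℕ) : MeasurableSpace (Equiv.Perm (Fin n)) := ⊤

instance permDiscreteMeasurableSpace (n : ℕ) :
    DiscreteMeasurableSpace (Equiv.Perm (Fin n)) :=
  ⟨fun _ => MeasurableSpace.measurableSet_top⟩

/-- The uniform probability measure on the symmetric group `S_n`. -/
noncomputable def uniformPerm (n : ℕ) : Measure (Equiv.Perm (Fin n)) :=
  uniformOn Set.univ

instance uniformPerm_isProbabilityMeasure (n : ℕ) : IsProbabilityMeasure (uniformPerm n) :=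
  instIsProbabilityMeasure_uniformOn_univ

/-- The number of inversions of a permutation `π`: the number of pairs of positions `i < j`
with `π j < π i`. -/
def inversionCount {n : ℕ} (π : Equiv.Perm (Fin n)) : ℕ :=
  (Finset.univ.filter fun p : Fin n × Fin n => p.1 < p.2 ∧ π p.2 < π p.1).card

/-- The mean `binom(n,2) / 2`. -/
noncomputable def inversionMean (n : ℕ) : ℝ := (n.choose 2 : ℝ) / 2

/-- The variance `σ_n² = n (2n+5) (n-1) / 72`, computed in the real numbers. -/
noncomputable def inversionVariance (n : ℕ) : ℝ :=
  (n : ℝ) * (2 * (n : ℝ) + 5) * ((n : ℝ) - 1) / 72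

/-- The standardized number of inversions `(I_n - binom(n,2)/2) / σ_n`. -/
noncomputable def standardizedInversions (n : ℕ) (π : Equiv.Perm (Fin n)) : ℝ :=
  ((inversionCount π : ℝ) - inversionMean n) / √(inversionVariance n)

/-! Sorting inversions by their right position gives an inversion table whose entry at `i` lies in
`{0, …, i}`. The table determines the permutation, and there are n! admissible tables, so a uniform
permutation has a uniform table: its entries are independent and uniform
(`hasLaw_inversionsEndingAt_pi`). Mean and variance follow by summation.

The normal approximation is Stein's method for W = ∑ X_i, with X_i independent, centred, |X_i| ≤ δ
and total variance 1. The solution f of f'(w) - w f(w) = 1(w < z) - Φ(z) is bounded and Lipschitz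
uniformly in z. Independence bounds E[W f(W)] below by any lower bound for E[f'(V)] over all V
within 2δ of W (`le_integral_sum_mul`). Stein's equation replaces f'(V) by an expression in W; the
jump of the indicator is absorbed by moving the threshold by 2δ, so no concentration inequality is
needed. The terms E[W f(W)] cancel, leaving a bound on P(W < z - 2δ) - Φ(z); -f gives the reverse
bound. Since Φ is Lipschitz, the Kolmogorov distance is O(δ). Table entries are at most n and σ_n
has order n^(3/2), so δ has order n^(-1/2), which also yields the limit law. -/

/-! ### The inversion table determines the permutation. -/

/-- The number of inversions of `π` whose right position is `i`. -/
def inversionsEndingAt {n : ℕ} (i : Fin n) (π : Equiv.Perm (Fin n)) : ℕ :=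
  (Finset.univ.filter fun j : Fin n => j < i ∧ π i < π j).card

theorem inversionCount_eq_sum {n : ℕ} (π : Equiv.Perm (Fin n)) :
    inversionCount π = ∑ i, inversionsEndingAt i π := by
  simp only [inversionCount, inversionsEndingAt, Finset.card_filter]
  rw [Fintype.sum_prod_type, Finset.sum_comm]

theorem inversionsEndingAt_le {n : ℕ} (i : Fin n) (π : Equiv.Perm (Fin n)) :
    inversionsEndingAt i π ≤ i := by
  calc inversionsEndingAt i π ≤ (Finset.Iio i).card :=
        Finset.card_le_card fun j hj => by
          simp only [Finset.mem_filter, Finset.mem_univ, true_and] at hj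
          simpa using hj.1
    _ = i := Fin.card_Iio i

/-- If two permutations order the positions below `k` alike, and have equally many inversions
ending at `k`, then they compare position `k` with the earlier ones alike. -/
theorem lt_iff_lt_of_inversionsEndingAt_eq {n : ℕ} {π ρ : Equiv.Perm (Fin n)} {k : Fin n}
    (hlt : ∀ i < k, ∀ j < k, (π i < π j ↔ ρ i < ρ j))
    (hk : inversionsEndingAt k π = inversionsEndingAt k ρ) {j : Fin n} (hj : j < k) :
    π k < π j ↔ ρ k < ρ j := by
  set A := Finset.univ.filter fun j : Fin n => j < k ∧ π k < π j with hA
  set B := Finset.univ.filter fun j : Fin n => j < k ∧ ρ k < ρ j with hB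
  have hcard : A.card = B.card := hk
  -- Both sets are upper sets for the common order on positions below `k`, hence nested; equal
  -- cardinality then makes them equal.
  have hAB : A ⊆ B ∨ B ⊆ A := by
    by_contra! h
    obtain ⟨h1, h2⟩ := h
    obtain ⟨a, haA, haB⟩ := Finset.not_subset.1 h1
    obtain ⟨b, hbB, hbA⟩ := Finset.not_subset.1 h2
    simp only [hA, hB, Finset.mem_filter, Finset.mem_univ, true_and, not_and, not_lt] at *
    have h3 := haB haA.1
    have h4 := hbA hbB.1
    have h5 : π b < π a := h4.trans_lt haA.2
    have h6 : ρ a < ρ b := h3.trans_lt hbB.2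
    exact lt_asymm h6 ((hlt b hbB.1 a haA.1).1 h5)
  have hEq : A = B := by
    rcases hAB with h | h
    · exact Finset.eq_of_subset_of_card_le h hcard.ge
    · exact (Finset.eq_of_subset_of_card_le h hcard.le).symm
  have := Finset.ext_iff.1 hEq j
  simpa [hA, hB, hj] using this

theorem lt_iff_lt_of_forall_inversionsEndingAt_eq {n : ℕ} {π ρ : Equiv.Perm (Fin n)}
    (h : ∀ i, inversionsEndingAt i π = inversionsEndingAt i ρ) (m : ℕ) :
    ∀ i j : Fin n, (i : ℕ) < m → (j : ℕ) < m → (π i < π j ↔ ρ i < ρ j) := by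
  induction m with
  | zero => intro i j hi; omega
  | succ m ih =>
    have key : ∀ i j : Fin n, (i : ℕ) = m → (j : ℕ) < m → (π i < π j ↔ ρ i < ρ j) := by
      intro i j hi hj
      refine lt_iff_lt_of_inversionsEndingAt_eq (fun a ha b hb => ?_) (h i) ?_
      · exact ih a b (hi ▸ ha) (hi ▸ hb)
      · exact Fin.lt_def.2 (hi ▸ hj)
    intro i j hi hj
    rcases Nat.lt_succ_iff_lt_or_eq.1 hi with hi' | hi' <;>
      rcases Nat.lt_succ_iff_lt_or_eq.1 hj with hj' | hj'
    · exact ih i j hi' hj'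
    · have hne : i ≠ j := fun e => by subst e; omega
      have := key j i hj' hi'
      rw [← not_le, ← not_le, not_iff_not, le_iff_lt_or_eq, le_iff_lt_or_eq, this]
      simp [hne.symm]
    · exact key i j hi' hj'
    · have : i = j := Fin.ext (hi'.trans hj'.symm)
      simp [this]

/-- Equal tables force equal order patterns, so `ρ * π⁻¹` is an order automorphism of `Fin n`, hence
the identity. -/
theorem inversionsEndingAt_injective (n : ℕ) :
    Function.Injective fun (π : Equiv.Perm (Fin n)) (i : Fin n) => inversionsEndingAt i π := by
  intro π ρ h
  have hlt := lt_iff_lt_of_forall_inversionsEndingAt_eq (fun i => congrFun h i) n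
  have hmono : StrictMono (ρ * π⁻¹) := by
    intro a b hab
    have := (hlt (π⁻¹ a) (π⁻¹ b) (Fin.isLt _) (Fin.isLt _)).1 (by simpa using hab)
    simpa using this
  have h1 : ρ * π⁻¹ = 1 := by
    have h2 : (hmono.orderIsoOfSurjective _ (ρ * π⁻¹).surjective) = OrderIso.refl (Fin n) :=
      Subsingleton.elim _ _
    ext a
    have := congrArg (fun e : Fin n ≃o Fin n => e a) h2
    simpa using congrArg Fin.val this
  exact (mul_inv_eq_one.1 h1).symm

theorem exists_inversionsEndingAt_eq {n : ℕ} (v : Fin n → ℕ) (hv : ∀ i, v i ≤ i) :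
    ∃ π : Equiv.Perm (Fin n), ∀ i, inversionsEndingAt i π = v i := by
  classical
  let F : Equiv.Perm (Fin n) → ((i : Fin n) → Fin (i + 1)) := fun π i =>
    ⟨inversionsEndingAt i π, Nat.lt_succ_of_le (inversionsEndingAt_le i π)⟩
  have hF : Function.Bijective F := by
    refine (Fintype.bijective_iff_injective_and_card F).2 ⟨fun π ρ h => ?_, ?_⟩
    · refine inversionsEndingAt_injective n (funext fun i => ?_)
      exact congrArg Fin.val (congrFun h i)
    · simp only [Fintype.card_perm, Fintype.card_fin, Fintype.card_pi]
      rw [← Finset.prod_range_add_one_eq_factorial]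
      exact (Fin.prod_univ_eq_prod_range (fun i => i + 1) n).symm
  obtain ⟨π, hπ⟩ := hF.surjective fun i => ⟨v i, Nat.lt_succ_of_le (hv i)⟩
  exact ⟨π, fun i => congrArg Fin.val (congrFun hπ i)⟩

/-! ### Joint law of the inversion table. -/

theorem uniformOn_Iic_singleton (m k : ℕ) :
    uniformOn (Set.Iic m) {k} = if k ≤ m then ((m : ENNReal) + 1)⁻¹ else 0 := by
  have h := uniformOn_apply_finset (s := Finset.Iic m) (t := {k})
  rw [Finset.coe_Iic, Finset.coe_singleton] at h
  rw [h]
  split_ifs with hk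
  · rw [Finset.inter_singleton_of_mem (by simpa using hk)]
    simp
  · rw [Finset.inter_singleton_of_notMem (by simpa using hk)]
    simp

instance isProbabilityMeasure_uniformOn_Iic (m : ℕ) :
    IsProbabilityMeasure (uniformOn (Set.Iic m)) :=
  isProbabilityMeasure_uniformOn (Set.finite_Iic m) Set.nonempty_Iic

/-- Both measures give each admissible table mass 1/n! = ∏ 1/(i+1) and any other table mass 0. The
product form encodes the marginals and the independence at once. -/
theorem hasLaw_inversionsEndingAt_pi (n : ℕ) :
    HasLaw (fun (π : Equiv.Perm (Fin n)) (i : Fin n) => inversionsEndingAt i π)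
      (Measure.pi fun i : Fin n => uniformOn (Set.Iic (i : ℕ))) (uniformPerm n) := by
  refine ⟨(measurable_of_finite _).aemeasurable, Measure.ext_of_singleton fun v => ?_⟩
  rw [Measure.map_apply (measurable_of_finite _) (measurableSet_singleton v),
    Measure.pi_singleton]
  simp only [uniformOn_Iic_singleton, uniformPerm, uniformOn_univ]
  by_cases hv : ∀ i, v i ≤ i
  · obtain ⟨π, hπ⟩ := exists_inversionsEndingAt_eq v hv
    have : (fun (π : Equiv.Perm (Fin n)) (i : Fin n) => inversionsEndingAt i π) ⁻¹' {v} = {π} := by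
      rw [← funext hπ]
      ext ρ
      exact (inversionsEndingAt_injective n).eq_iff
    rw [this, Measure.count_singleton, Finset.prod_congr rfl fun i _ => if_pos (hv i),
      Fintype.card_perm, Fintype.card_fin, ← Finset.prod_range_add_one_eq_factorial,
      Fin.prod_univ_eq_prod_range (fun i => ((i : ENNReal) + 1)⁻¹) n, one_div]
    push_cast
    rw [ENNReal.prod_inv_distrib]
    intro i _ j _ _
    left
    simp
  · have : (fun (π : Equiv.Perm (Fin n)) (i : Fin n) => inversionsEndingAt i π) ⁻¹' {v} = ∅ := by
      ext ρ
      simp only [Set.mem_preimage, Set.mem_singleton_iff, Set.mem_empty_iff_false, iff_false]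
      rintro rfl
      exact hv fun i => inversionsEndingAt_le i ρ
    push Not at hv
    obtain ⟨i, hi⟩ := hv
    rw [this, Finset.prod_eq_zero (Finset.mem_univ i) (if_neg hi.not_ge)]
    simp

theorem hasLaw_inversionsEndingAt {n : ℕ} (i : Fin n) :
    HasLaw (inversionsEndingAt i) (uniformOn (Set.Iic (i : ℕ))) (uniformPerm n) :=
  (measurePreserving_eval (fun i : Fin n => uniformOn (Set.Iic (i : ℕ))) i).comp_hasLaw
    (hasLaw_inversionsEndingAt_pi n)

theorem iIndepFun_inversionsEndingAt (n : ℕ) :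
    iIndepFun (fun i : Fin n => inversionsEndingAt i) (uniformPerm n) :=
  (iIndepFun_iff_hasLaw_pi_pi fun i => hasLaw_inversionsEndingAt i).2
    (hasLaw_inversionsEndingAt_pi n)

/-! ### Density and distribution function of the standard normal law. -/

section StandardNormal

theorem gaussianPDFReal_zero_one (x : ℝ) :
    gaussianPDFReal 0 1 x = (√(2 * Real.pi))⁻¹ * Real.exp (-x ^ 2 / 2) := by
  simp [gaussianPDFReal]

theorem continuous_gaussianPDFReal_zero_one : Continuous (gaussianPDFReal 0 1) := by
  have : gaussianPDFReal 0 1 = fun x => (√(2 * Real.pi))⁻¹ * Real.exp (-x ^ 2 / 2) :=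
    funext gaussianPDFReal_zero_one
  rw [this]
  fun_prop

theorem gaussianPDFReal_zero_one_pos (x : ℝ) : 0 < gaussianPDFReal 0 1 x :=
  gaussianPDFReal_pos 0 1 x one_ne_zero

theorem gaussianPDFReal_zero_one_le_one (x : ℝ) : gaussianPDFReal 0 1 x ≤ 1 := by
  rw [gaussianPDFReal_zero_one]
  have h1 : Real.exp (-x ^ 2 / 2) ≤ 1 := Real.exp_le_one_iff.2 (by nlinarith [sq_nonneg x])
  have h2 : (√(2 * Real.pi))⁻¹ ≤ 1 := by
    refine inv_le_one_of_one_le₀ (Real.one_le_sqrt.2 ?_)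
    linarith [Real.pi_gt_three]
  exact mul_le_one₀ h2 (Real.exp_nonneg _) h1

/-- The maximum on [-1, 1] is √(2π)·e^(1/2) ≈ 4.13; 5 is a convenient upper bound. -/
theorem inv_gaussianPDFReal_zero_one_le {x : ℝ} (hx : |x| ≤ 1) :
    (gaussianPDFReal 0 1 x)⁻¹ ≤ 5 := by
  rw [gaussianPDFReal_zero_one, mul_inv, inv_inv, ← Real.exp_neg]
  have h1 : √(2 * Real.pi) ≤ 5 / 2 + 1 / 100 := by
    refine Real.sqrt_le_iff.2 ⟨by norm_num, ?_⟩
    nlinarith [Real.pi_lt_d2]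
  have h2 : Real.exp (-(-x ^ 2 / 2)) ≤ 7 / 4 := by
    have h3 : -(-x ^ 2 / 2) ≤ 1 / 2 := by nlinarith [sq_le_one_iff_abs_le_one x |>.2 hx]
    have h4 : Real.exp (1 / 2) ^ 2 < 2.7182818286 := by
      rw [← Real.exp_nat_mul]
      norm_num
      exact Real.exp_one_lt_d9.trans_le (by norm_num)
    have h5 : Real.exp (1 / 2) ≤ 7 / 4 := by
      by_contra! h
      nlinarith
    exact (Real.exp_le_exp.2 h3).trans h5
  calc _ ≤ (5 / 2 + 1 / 100) * (7 / 4 : ℝ) := by gcongr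
    _ ≤ 5 := by norm_num

theorem hasDerivAt_gaussianPDFReal_zero_one (x : ℝ) :
    HasDerivAt (gaussianPDFReal 0 1) (-(x * gaussianPDFReal 0 1 x)) x := by
  have : gaussianPDFReal 0 1 = fun x => (√(2 * Real.pi))⁻¹ * Real.exp (-x ^ 2 / 2) :=
    funext gaussianPDFReal_zero_one
  rw [this]
  convert! (((hasDerivAt_pow 2 x).fun_neg.div_const 2).exp.const_mul (√(2 * Real.pi))⁻¹) using 1
  norm_num
  ring

theorem tendsto_gaussianPDFReal_zero_one_atTop :
    Tendsto (gaussianPDFReal 0 1) atTop (nhds 0) := by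
  have : gaussianPDFReal 0 1 = fun x => (√(2 * Real.pi))⁻¹ * Real.exp (-x ^ 2 / 2) :=
    funext gaussianPDFReal_zero_one
  rw [this, ← mul_zero (√(2 * Real.pi))⁻¹]
  refine (Real.tendsto_exp_atBot.comp ?_).const_mul _
  have h : Tendsto (fun x : ℝ => x ^ 2 / 2) atTop atTop :=
    (tendsto_pow_atTop two_ne_zero).atTop_div_const two_pos
  simp only [neg_div]
  exact tendsto_neg_atTop_atBot.comp h

theorem cdf_gaussianReal_zero_one_eq (x : ℝ) :
    cdf (gaussianReal 0 1) x = ∫ t in Set.Iic x, gaussianPDFReal 0 1 t := by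
  rw [cdf_eq_real, measureReal_def, gaussianReal_apply_eq_integral 0 one_ne_zero,
    ENNReal.toReal_ofReal (integral_nonneg fun t => gaussianPDFReal_nonneg 0 1 t)]

theorem hasDerivAt_cdf_gaussianReal (x : ℝ) :
    HasDerivAt (cdf (gaussianReal 0 1)) (gaussianPDFReal 0 1 x) x := by
  have hint := integrable_gaussianPDFReal 0 1
  have h : (cdf (gaussianReal 0 1) : ℝ → ℝ) = fun x =>
      (∫ t in (0 : ℝ)..x, gaussianPDFReal 0 1 t) + cdf (gaussianReal 0 1) 0 := by
    ext y
    rw [cdf_gaussianReal_zero_one_eq, cdf_gaussianReal_zero_one_eq,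
      ← intervalIntegral.integral_Iic_sub_Iic hint.integrableOn hint.integrableOn]
    ring
  rw [h]
  exact (continuous_gaussianPDFReal_zero_one.integral_hasStrictDerivAt 0 x).hasDerivAt.add_const _

theorem continuous_cdf_gaussianReal : Continuous (cdf (gaussianReal 0 1)) :=
  continuous_iff_continuousAt.2 fun x => (hasDerivAt_cdf_gaussianReal x).continuousAt

theorem one_sub_cdf_gaussianReal (x : ℝ) :
    1 - cdf (gaussianReal 0 1) x = ∫ t in Set.Ioi x, gaussianPDFReal 0 1 t := by
  have hint := integrable_gaussianPDFReal 0 1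
  have h := intervalIntegral.integral_Iic_add_Ioi (b := x) hint.integrableOn hint.integrableOn
  rw [integral_gaussianPDFReal_eq_one 0 one_ne_zero] at h
  rw [cdf_gaussianReal_zero_one_eq, ← h]
  ring

theorem cdf_gaussianReal_neg (x : ℝ) :
    cdf (gaussianReal 0 1) (-x) = 1 - cdf (gaussianReal 0 1) x := by
  rw [one_sub_cdf_gaussianReal, cdf_gaussianReal_zero_one_eq, ← integral_comp_neg_Ioi]
  simp [gaussianPDFReal_zero_one]

/-- The Mills ratio inequality. -/
theorem mul_one_sub_cdf_gaussianReal_le {x : ℝ} (hx : 0 ≤ x) :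
    x * (1 - cdf (gaussianReal 0 1) x) ≤ gaussianPDFReal 0 1 x := by
  -- For t > x the factor x is at most t, and t φ(t) has antiderivative -φ.
  have hd : ∀ t ∈ Set.Ici x, HasDerivAt (fun t => -gaussianPDFReal 0 1 t)
      (t * gaussianPDFReal 0 1 t) t := fun t _ => by
    simpa using (hasDerivAt_gaussianPDFReal_zero_one t).fun_neg
  have hnn : ∀ t ∈ Set.Ioi x, 0 ≤ t * gaussianPDFReal 0 1 t := fun t ht =>
    mul_nonneg (hx.trans (le_of_lt ht)) (gaussianPDFReal_nonneg 0 1 t)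
  have hlim : Tendsto (fun t => -gaussianPDFReal 0 1 t) atTop (nhds 0) := by
    simpa using tendsto_gaussianPDFReal_zero_one_atTop.neg
  have hI := integrableOn_Ioi_deriv_of_nonneg' hd hnn hlim
  have hv := integral_Ioi_of_hasDerivAt_of_nonneg' hd hnn hlim
  rw [one_sub_cdf_gaussianReal, ← integral_const_mul]
  calc _ ≤ ∫ t in Set.Ioi x, t * gaussianPDFReal 0 1 t := by
        refine setIntegral_mono_on
          ((integrable_gaussianPDFReal 0 1).const_mul x).integrableOn hI measurableSet_Ioi ?_
        intro t ht
        exact mul_le_mul_of_nonneg_right (le_of_lt ht) (gaussianPDFReal_nonneg 0 1 t)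
    _ = gaussianPDFReal 0 1 x := by rw [hv]; ring

theorem neg_mul_cdf_gaussianReal_le {x : ℝ} (hx : x ≤ 0) :
    -x * cdf (gaussianReal 0 1) x ≤ gaussianPDFReal 0 1 x := by
  have h := mul_one_sub_cdf_gaussianReal_le (x := -x) (by linarith)
  rw [cdf_gaussianReal_neg] at h
  simpa [gaussianPDFReal_zero_one] using h

theorem cdf_gaussianReal_sub_le {x y : ℝ} (hxy : x ≤ y) :
    cdf (gaussianReal 0 1) y - cdf (gaussianReal 0 1) x ≤ y - x := by
  have h := image_sub_le_mul_sub_of_deriv_le (f := cdf (gaussianReal 0 1)) (C := 1)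
    (fun t => (hasDerivAt_cdf_gaussianReal t).differentiableAt)
    (fun t => (hasDerivAt_cdf_gaussianReal t).deriv ▸ gaussianPDFReal_zero_one_le_one t) hxy
  simpa using h

end StandardNormal

/-! ### Stein's equation for half-lines. -/

section Stein

/-- The bounded solution of Stein's equation `f' w - w * f w = 𝟙(w < z) - Φ z`. -/
noncomputable def steinSolution (z w : ℝ) : ℝ :=
  cdf (gaussianReal 0 1) (min w z) * (1 - cdf (gaussianReal 0 1) (max w z)) /
    gaussianPDFReal 0 1 w

/-- The right derivative of `steinSolution z`. -/
noncomputable def steinDeriv (z w : ℝ) : ℝ :=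
  w * steinSolution z w + (if w < z then 1 else 0) - cdf (gaussianReal 0 1) z

theorem continuous_steinSolution (z : ℝ) : Continuous (steinSolution z) := by
  have h := continuous_cdf_gaussianReal
  refine Continuous.div ?_ continuous_gaussianPDFReal_zero_one
    fun w => (gaussianPDFReal_zero_one_pos w).ne'
  exact (h.comp (continuous_id.min continuous_const)).mul
    (continuous_const.sub (h.comp (continuous_id.max continuous_const)))

/-- The solution has a corner at `w = z`, so only a right derivative exists everywhere; the strict
inequality in the indicator matches its value at the corner. -/
theorem hasDerivWithinAt_steinSolution (z w : ℝ) :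
    HasDerivWithinAt (steinSolution z) (steinDeriv z w) (Set.Ici w) w := by
  have hφ := hasDerivAt_gaussianPDFReal_zero_one w
  have hΦ := hasDerivAt_cdf_gaussianReal w
  have hne := (gaussianPDFReal_zero_one_pos w).ne'
  rcases lt_or_ge w z with h | h
  · have hd := (hΦ.mul_const (1 - cdf (gaussianReal 0 1) z)).fun_div hφ hne
    have heq : steinSolution z =ᶠ[nhds w] fun w =>
        cdf (gaussianReal 0 1) w * (1 - cdf (gaussianReal 0 1) z) / gaussianPDFReal 0 1 w := by
      filter_upwards [gt_mem_nhds h] with y hy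
      rw [steinSolution, min_eq_left hy.le, max_eq_right hy.le]
    refine HasDerivAt.hasDerivWithinAt ?_
    convert! hd.congr_of_eventuallyEq heq using 1
    rw [steinDeriv, if_pos h, heq.eq_of_nhds]
    field_simp
    ring
  · have hd := ((hΦ.const_sub 1).const_mul (cdf (gaussianReal 0 1) z)).fun_div hφ hne
    have heq : ∀ y ∈ Set.Ici w, steinSolution z y =
        cdf (gaussianReal 0 1) z * (1 - cdf (gaussianReal 0 1) y) / gaussianPDFReal 0 1 y := by
      intro y hy
      rw [steinSolution, min_eq_right (h.trans hy), max_eq_left (h.trans hy)]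
    convert! hd.hasDerivWithinAt.congr heq (heq w Set.self_mem_Ici) using 1
    rw [steinDeriv, if_neg h.not_gt, heq w Set.self_mem_Ici]
    field_simp
    ring

theorem steinSolution_nonneg (z w : ℝ) : 0 ≤ steinSolution z w :=
  div_nonneg (mul_nonneg (cdf_nonneg _ _) (sub_nonneg.2 (cdf_le_one _ _)))
    (gaussianPDFReal_zero_one_pos w).le

/-- The numerator is at most 1 - Φ(w) and at most Φ(w), so the Mills inequality for the sign of `w`
applies. -/
theorem abs_mul_steinSolution_le (z w : ℝ) : |w| * steinSolution z w ≤ 1 := by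
  rw [steinSolution, ← mul_div_assoc, div_le_one (gaussianPDFReal_zero_one_pos w)]
  have hmin := monotone_cdf (gaussianReal 0 1) (min_le_left w z)
  have hmax := monotone_cdf (gaussianReal 0 1) (le_max_left w z)
  have h1 := cdf_nonneg (gaussianReal 0 1) (min w z)
  have h2 := cdf_le_one (gaussianReal 0 1) (min w z)
  have h3 := cdf_nonneg (gaussianReal 0 1) (max w z)
  have h4 := cdf_le_one (gaussianReal 0 1) (max w z)
  rcases le_total 0 w with hw | hw
  · rw [abs_of_nonneg hw]
    refine le_trans ?_ (mul_one_sub_cdf_gaussianReal_le hw)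
    refine mul_le_mul_of_nonneg_left ?_ hw
    nlinarith
  · rw [abs_of_nonpos hw]
    refine le_trans ?_ (neg_mul_cdf_gaussianReal_le hw)
    refine mul_le_mul_of_nonneg_left ?_ (by linarith)
    nlinarith

theorem steinSolution_le (z w : ℝ) : steinSolution z w ≤ 5 := by
  rcases le_total |w| 1 with h | h
  · have h1 := inv_gaussianPDFReal_zero_one_le h
    rw [steinSolution, div_eq_mul_inv]
    refine le_trans (mul_le_of_le_one_left ?_ ?_) h1
    · exact (inv_pos.2 (gaussianPDFReal_zero_one_pos w)).le
    · exact mul_le_one₀ (cdf_le_one _ _) (sub_nonneg.2 (cdf_le_one _ _))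
        (sub_le_self _ (cdf_nonneg _ _))
  · have := abs_mul_steinSolution_le z w
    nlinarith [steinSolution_nonneg z w]

theorem abs_steinDeriv_le (z w : ℝ) : |steinDeriv z w| ≤ 2 := by
  have h1 : |w * steinSolution z w| ≤ 1 := by
    rw [abs_mul, abs_of_nonneg (steinSolution_nonneg z w)]
    exact abs_mul_steinSolution_le z w
  have h2 := cdf_nonneg (gaussianReal 0 1) z
  have h3 := cdf_le_one (gaussianReal 0 1) z
  rw [abs_le] at h1 ⊢
  rw [steinDeriv]
  split_ifs <;> constructor <;> linarith [h1.1, h1.2]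

theorem abs_steinSolution_sub_le (z a b : ℝ) :
    |steinSolution z a - steinSolution z b| ≤ 2 * |a - b| := by
  wlog hab : b ≤ a generalizing a b
  · rw [abs_sub_comm, abs_sub_comm a b]
    exact this b a (le_of_not_ge hab)
  have := norm_image_sub_le_of_norm_deriv_right_le_segment (C := 2)
    (continuous_steinSolution z).continuousOn
    (fun x (_ : x ∈ Set.Ico b a) => hasDerivWithinAt_steinSolution z x)
    (fun x _ => abs_steinDeriv_le z x) a ⟨hab, le_rfl⟩
  rwa [Real.norm_eq_abs, ← abs_of_nonneg (sub_nonneg.2 hab)] at this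

theorem abs_mul_steinSolution_sub_le (z a b : ℝ) :
    |a * steinSolution z a - b * steinSolution z b| ≤ |a - b| * (5 + 2 * |b|) := by
  have h1 : a * steinSolution z a - b * steinSolution z b =
      (a - b) * steinSolution z a + b * (steinSolution z a - steinSolution z b) := by ring
  rw [h1]
  refine (abs_add_le _ _).trans ?_
  rw [abs_mul, abs_mul, abs_of_nonneg (steinSolution_nonneg z a)]
  have h2 := mul_le_mul_of_nonneg_left (steinSolution_le z a) (abs_nonneg (a - b))
  have h3 := mul_le_mul_of_nonneg_left (abs_steinSolution_sub_le z a b) (abs_nonneg b)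
  linarith

end Stein

/-! ### Berry–Esseen bound for bounded independent summands. -/

section BerryEsseen

/-- Secant slopes of `G` on [-δ, δ] are at least `m`, because a lower bound on right derivatives
suffices for a continuous function. -/
theorem mul_sq_le_mul_sub_of_le_deriv_right {G D : ℝ → ℝ} {m δ x : ℝ} (hG : Continuous G)
    (hD : ∀ y, HasDerivWithinAt G (D y) (Set.Ici y) y) (hm : ∀ y, |y| ≤ δ → m ≤ D y)
    (hx : |x| ≤ δ) : m * x ^ 2 ≤ x * (G x - G 0) := by
  have key : ∀ a b, a ≤ b → |a| ≤ δ → |b| ≤ δ → m * (b - a) ≤ G b - G a := by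
    intro a b hab ha hb
    have h := image_le_of_deriv_right_le_deriv_boundary (f := fun y => m * (y - a) + G a)
      (f' := fun _ => m) (a := a) (b := b) (B := G) (B' := D) (by fun_prop)
      (fun y _ => by
        simpa using ((((hasDerivAt_id y).sub_const a).const_mul m).add_const
          (G a)).hasDerivWithinAt)
      (by simp) hG.continuousOn (fun y _ => hD y)
      (fun y hy => hm y (abs_le.2 ⟨by linarith [(abs_le.1 ha).1, hy.1],
        by linarith [(abs_le.1 hb).2, hy.2.le]⟩)) (Set.right_mem_Icc.2 hab)
    linarith
  have hδ : |(0 : ℝ)| ≤ δ := by simpa using (abs_nonneg x).trans hx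
  rcases le_total 0 x with h0 | h0
  · nlinarith [key 0 x h0 hδ hx]
  · nlinarith [key x 0 h0 hx hδ]

variable {Ω : Type*} [Finite Ω] [MeasurableSpace Ω] [MeasurableSingletonClass Ω]
  {μ : Measure Ω} [IsProbabilityMeasure μ]

theorem ProbabilityTheory.IndepFun.integral_comp_prodMk_of_finite {X Y : Ω → ℝ}
    (hXY : IndepFun X Y μ) {F : ℝ × ℝ → ℝ} (hF : Continuous F) :
    ∫ ω, F (X ω, Y ω) ∂μ = ∫ ω, ∫ ω', F (X ω, Y ω') ∂μ ∂μ := by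
  have hX : Measurable X := measurable_of_finite X
  have hY : Measurable Y := measurable_of_finite Y
  have hmap := hXY.map_prod_eq_prod_map_map hX.aemeasurable hY.aemeasurable
  have hint : Integrable F ((μ.map X).prod (μ.map Y)) := by
    rw [← hmap, integrable_map_measure hF.aestronglyMeasurable (hX.prodMk hY).aemeasurable]
    exact Integrable.of_finite
  have h1 : ∫ ω, F (X ω, Y ω) ∂μ = ∫ p, F p ∂((μ.map X).prod (μ.map Y)) := by
    rw [← hmap, integral_map (hX.prodMk hY).aemeasurable hF.aestronglyMeasurable]
  rw [h1, integral_prod F hint, integral_map hX.aemeasurable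
    hint.integral_prod_left.aestronglyMeasurable]
  refine integral_congr_ae (ae_of_all _ fun ω => ?_)
  exact integral_map hY.aemeasurable (by fun_prop)

theorem hasDerivWithinAt_integral_of_finite {f D : ℝ → ℝ}
    (hD : ∀ w, HasDerivWithinAt f (D w) (Set.Ici w) w) (Y : Ω → ℝ) (x : ℝ) :
    HasDerivWithinAt (fun x => ∫ ω, f (Y ω + x) ∂μ) (∫ ω, D (Y ω + x) ∂μ) (Set.Ici x) x := by
  have := Fintype.ofFinite Ω
  have h : ∀ g : Ω → ℝ, ∫ ω, g ω ∂μ = ∑ ω, μ.real {ω} * g ω := fun g => by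
    rw [integral_fintype Integrable.of_finite]
    rfl
  simp only [h]
  refine HasDerivWithinAt.fun_sum fun ω _ => HasDerivWithinAt.const_mul _ ?_
  have hY : HasDerivWithinAt (fun x => Y ω + x) 1 (Set.Ici x) x :=
    ((hasDerivAt_id x).const_add (Y ω)).hasDerivWithinAt
  have h := (hD (Y ω + x)).comp x hY fun y hy => by simpa using hy
  rwa [mul_one] at h

/-- If the right derivative of `f` at points near `X + Y` has mean at least `m`, then a small
centred summand `X` satisfies `m * E[X ^ 2] ≤ E[X * f (X + Y)]`. -/
theorem mul_integral_sq_le_integral_mul {X Y : Ω → ℝ} (hXY : IndepFun X Y μ) {δ m : ℝ}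
    (hX : ∀ ω, |X ω| ≤ δ) (hX0 : ∫ ω, X ω ∂μ = 0) {f D : ℝ → ℝ} (hf : Continuous f)
    (hD : ∀ w, HasDerivWithinAt f (D w) (Set.Ici w) w)
    (hm : ∀ x, |x| ≤ δ → m ≤ ∫ ω, D (Y ω + x) ∂μ) :
    m * ∫ ω, X ω ^ 2 ∂μ ≤ ∫ ω, X ω * f (X ω + Y ω) ∂μ := by
  set G : ℝ → ℝ := fun x => ∫ ω, f (Y ω + x) ∂μ with hG
  have hGc : Continuous G := by
    have := Fintype.ofFinite Ω
    have : G = fun x => ∑ ω, μ.real {ω} * f (Y ω + x) := funext fun x =>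
      integral_fintype Integrable.of_finite
    rw [this]
    fun_prop
  -- Independence averages out `Y`; subtracting the constant `G 0` is free because `X` is centred.
  have h1 : ∫ ω, X ω * f (X ω + Y ω) ∂μ = ∫ ω, X ω * (G (X ω) - G 0) ∂μ := by
    rw [hXY.integral_comp_prodMk_of_finite (F := fun p => p.1 * f (p.1 + p.2)) (by fun_prop)]
    simp only [integral_const_mul, mul_sub]
    rw [integral_sub Integrable.of_finite Integrable.of_finite, integral_mul_const, hX0,
      zero_mul, sub_zero]
    simp only [hG, add_comm]
  rw [h1, ← integral_const_mul]
  exact integral_mono Integrable.of_finite Integrable.of_finite fun ω =>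
    mul_sq_le_mul_sub_of_le_deriv_right hGc
      (hasDerivWithinAt_integral_of_finite hD Y) hm (hX ω)

theorem abs_mul_steinSolution_sub_le_of_abs_sub_le (z : ℝ) {δ a b : ℝ} (h : |a - b| ≤ δ) :
    |a * steinSolution z a - b * steinSolution z b| ≤ δ * (5 + 2 * |b|) :=
  (abs_mul_steinSolution_sub_le z a b).trans
    (mul_le_mul_of_nonneg_right h (by positivity))

/-- Stein's equation at `a`, rewritten in terms of `b`: the smooth part costs a Lipschitz error, and
shifting the threshold by `δ` handles the jump. -/
theorem steinDeriv_ge (z : ℝ) {δ a b : ℝ} (h : |a - b| ≤ δ) :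
    b * steinSolution z b - δ * (5 + 2 * |b|) + (if b < z - δ then 1 else 0) -
      cdf (gaussianReal 0 1) z ≤ steinDeriv z a := by
  have h1 := (abs_le.1 (abs_mul_steinSolution_sub_le_of_abs_sub_le z h)).1
  have h2 : (if b < z - δ then 1 else 0 : ℝ) ≤ if a < z then 1 else 0 := by
    split_ifs with h3 h4 h4 <;> linarith [(abs_le.1 h).2]
  rw [steinDeriv]
  linarith

theorem steinDeriv_le (z : ℝ) {δ a b : ℝ} (h : |a - b| ≤ δ) :
    steinDeriv z a ≤ b * steinSolution z b + δ * (5 + 2 * |b|) +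
      (if b < z + δ then 1 else 0) - cdf (gaussianReal 0 1) z := by
  have h1 := (abs_le.1 (abs_mul_steinSolution_sub_le_of_abs_sub_le z h)).2
  have h2 : (if a < z then 1 else 0 : ℝ) ≤ if b < z + δ then 1 else 0 := by
    split_ifs with h3 h4 h4 <;> linarith [(abs_le.1 h).1]
  rw [steinDeriv]
  linarith

variable {ι : Type*} [Fintype ι] {X : ι → Ω → ℝ}

/-- A lower bound `m` for the mean right derivative of `f` near `∑ i, X i` is a lower bound for
`E[W * f W]`, where `W = ∑ i, X i` has unit variance. -/
theorem le_integral_sum_mul (hind : iIndepFun X μ) {δ m : ℝ}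
    (hX : ∀ i ω, |X i ω| ≤ δ) (hX0 : ∀ i, ∫ ω, X i ω ∂μ = 0)
    (hvar : ∑ i, ∫ ω, X i ω ^ 2 ∂μ = 1) {f D : ℝ → ℝ} (hf : Continuous f)
    (hD : ∀ w, HasDerivWithinAt f (D w) (Set.Ici w) w)
    (hm : ∀ V : Ω → ℝ, (∀ ω, |V ω - ∑ i, X i ω| ≤ 2 * δ) → m ≤ ∫ ω, D (V ω) ∂μ) :
    m ≤ ∫ ω, (∑ i, X i ω) * f (∑ i, X i ω) ∂μ := by
  classical
  have hstep : ∀ i, m * ∫ ω, X i ω ^ 2 ∂μ ≤ ∫ ω, X i ω * f (∑ j, X j ω) ∂μ := by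
    intro i
    have hI : IndepFun (X i) (∑ j ∈ Finset.univ.erase i, X j) μ :=
      (hind.indepFun_finsetSum_of_notMem (fun j => measurable_of_finite (X j))
        (Finset.notMem_erase i Finset.univ)).symm
    have hsum : ∀ ω, ∑ j, X j ω = X i ω + (∑ j ∈ Finset.univ.erase i, X j) ω := fun ω => by
      rw [Finset.sum_apply, Finset.add_sum_erase _ (fun j => X j ω) (Finset.mem_univ i)]
    -- Replacing `X i` by `x` in the full sum changes it by `x - X i`, which gives the 2δ.
    have h := mul_integral_sq_le_integral_mul hI (hX i) (hX0 i) hf hD (m := m) fun x hx =>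
      hm _ fun ω => by
        rw [hsum ω]
        calc _ = |x - X i ω| := by ring_nf
          _ ≤ |x| + |X i ω| := abs_sub _ _
          _ ≤ 2 * δ := by linarith [hX i ω]
    simpa only [hsum] using h
  calc m = ∑ i, m * ∫ ω, X i ω ^ 2 ∂μ := by rw [← Finset.mul_sum, hvar, mul_one]
    _ ≤ ∑ i, ∫ ω, X i ω * f (∑ j, X j ω) ∂μ := Finset.sum_le_sum fun i _ => hstep i
    _ = ∫ ω, (∑ i, X i ω) * f (∑ i, X i ω) ∂μ := by
      rw [← integral_finsetSum _ fun i _ => Integrable.of_finite]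
      simp only [Finset.sum_mul]

theorem integral_abs_sum_le_one (hind : iIndepFun X μ) (hX0 : ∀ i, ∫ ω, X i ω ∂μ = 0)
    (hvar : ∑ i, ∫ ω, X i ω ^ 2 ∂μ = 1) : ∫ ω, |∑ i, X i ω| ∂μ ≤ 1 := by
  have hsq : ∫ ω, (∑ i, X i ω) ^ 2 ∂μ = 1 := by
    have h := IndepFun.variance_sum (μ := μ) (X := X) (s := Finset.univ)
      (fun i _ => MemLp.of_discrete) (fun i _ j _ hij => hind.indepFun hij)
    have h0 : ∫ ω, (∑ i, X i) ω ∂μ = 0 := by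
      simp only [Finset.sum_apply]
      rw [integral_finsetSum _ fun i _ => Integrable.of_finite]
      simp [hX0]
    rw [variance_of_integral_eq_zero (measurable_of_finite _).aemeasurable h0,
      Finset.sum_congr rfl fun i _ => variance_of_integral_eq_zero
        (measurable_of_finite _).aemeasurable (hX0 i), hvar] at h
    simpa using h
  have h1 : ∫ ω, |∑ i, X i ω| ∂μ ≤ ∫ ω, (1 / 2 + (1 / 2) * (∑ i, X i ω) ^ 2) ∂μ := by
    refine integral_mono Integrable.of_finite Integrable.of_finite fun ω => ?_
    have := sq_nonneg (|∑ i, X i ω| - 1)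
    have h2 := sq_abs (∑ i, X i ω)
    change |∑ i, X i ω| ≤ 1 / 2 + (1 / 2) * (∑ i, X i ω) ^ 2
    nlinarith
  rw [integral_add Integrable.of_finite Integrable.of_finite, integral_const_mul, hsq] at h1
  norm_num at h1
  exact h1

theorem integral_ite_lt (ν : Measure Ω) (W : Ω → ℝ) (c : ℝ) :
    ∫ ω, (if W ω < c then 1 else 0 : ℝ) ∂ν = ν.real {ω | W ω < c} := by
  have hs : MeasurableSet {ω | W ω < c} := measurable_of_finite W measurableSet_Iio
  rw [← integral_indicator_one hs]
  rfl

/-- With `m` the mean of the lower bound from `steinDeriv_ge`, E[W f(W)] cancels from both sides.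
The remaining error is 2δ(5 + 2 E|W|) ≤ 14δ. -/
theorem measureReal_sum_lt_le (hind : iIndepFun X μ) {δ : ℝ}
    (hδ : 0 ≤ δ) (hX : ∀ i ω, |X i ω| ≤ δ) (hX0 : ∀ i, ∫ ω, X i ω ∂μ = 0)
    (hvar : ∑ i, ∫ ω, X i ω ^ 2 ∂μ = 1) (z : ℝ) :
    μ.real {ω | ∑ i, X i ω < z - 2 * δ} ≤ cdf (gaussianReal 0 1) z + 14 * δ := by
  set W : Ω → ℝ := fun ω => ∑ i, X i ω with hW
  have habs : ∫ ω, |W ω| ∂μ ≤ 1 := integral_abs_sum_le_one hind hX0 hvar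
  have h := le_integral_sum_mul hind hX hX0 hvar (continuous_steinSolution z)
    (hasDerivWithinAt_steinSolution z) (m := ∫ ω, (W ω * steinSolution z (W ω) -
      2 * δ * (5 + 2 * |W ω|) + (if W ω < z - 2 * δ then 1 else 0) -
      cdf (gaussianReal 0 1) z) ∂μ) fun V hV =>
    integral_mono Integrable.of_finite Integrable.of_finite fun ω => steinDeriv_ge z (hV ω)
  rw [integral_sub Integrable.of_finite Integrable.of_finite,
    integral_add Integrable.of_finite Integrable.of_finite,
    integral_sub Integrable.of_finite Integrable.of_finite, integral_ite_lt,
    integral_const_mul, integral_add Integrable.of_finite Integrable.of_finite,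
    integral_const_mul] at h
  simp only [integral_const, probReal_univ, one_smul] at h
  change μ.real {ω | W ω < z - 2 * δ} ≤ _
  nlinarith

theorem le_measureReal_sum_lt (hind : iIndepFun X μ) {δ : ℝ}
    (hδ : 0 ≤ δ) (hX : ∀ i ω, |X i ω| ≤ δ) (hX0 : ∀ i, ∫ ω, X i ω ∂μ = 0)
    (hvar : ∑ i, ∫ ω, X i ω ^ 2 ∂μ = 1) (z : ℝ) :
    cdf (gaussianReal 0 1) z - 14 * δ ≤ μ.real {ω | ∑ i, X i ω < z + 2 * δ} := by
  set W : Ω → ℝ := fun ω => ∑ i, X i ω with hW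
  have habs : ∫ ω, |W ω| ∂μ ≤ 1 := integral_abs_sum_le_one hind hX0 hvar
  have h := le_integral_sum_mul hind hX hX0 hvar (continuous_steinSolution z).neg
    (fun w => (hasDerivWithinAt_steinSolution z w).neg)
    (m := -∫ ω, (W ω * steinSolution z (W ω) +
      2 * δ * (5 + 2 * |W ω|) + (if W ω < z + 2 * δ then 1 else 0) -
      cdf (gaussianReal 0 1) z) ∂μ) fun V hV => by
    rw [integral_neg]
    exact neg_le_neg (integral_mono Integrable.of_finite Integrable.of_finite
      fun ω => steinDeriv_le z (hV ω))
  simp only [Pi.neg_apply, mul_neg, integral_neg] at h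
  rw [integral_sub Integrable.of_finite Integrable.of_finite,
    integral_add Integrable.of_finite Integrable.of_finite,
    integral_add Integrable.of_finite Integrable.of_finite, integral_ite_lt,
    integral_const_mul, integral_add Integrable.of_finite Integrable.of_finite,
    integral_const_mul] at h
  simp only [integral_const, probReal_univ, one_smul] at h
  change _ ≤ μ.real {ω | W ω < z + 2 * δ}
  nlinarith

/-- A Berry–Esseen bound for sums of uniformly bounded independent random variables on a finite
probability space. -/
theorem abs_measureReal_sum_le_sub_cdf_le (hind : iIndepFun X μ) {δ : ℝ}
    (hδ : 0 < δ) (hX : ∀ i ω, |X i ω| ≤ δ) (hX0 : ∀ i, ∫ ω, X i ω ∂μ = 0)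
    (hvar : ∑ i, ∫ ω, X i ω ^ 2 ∂μ = 1) (x : ℝ) :
    |μ.real {ω | ∑ i, X i ω ≤ x} - cdf (gaussianReal 0 1) x| ≤ 17 * δ := by
  -- The shift is 3δ rather than 2δ because {W ≤ x} must fit inside a strict event. Moving Φ costs
  -- at most 3δ, so the total is 14δ + 3δ.
  have h1 := measureReal_sum_lt_le hind hδ.le hX hX0 hvar (x + 3 * δ)
  have h2 := le_measureReal_sum_lt hind hδ.le hX hX0 hvar (x - 2 * δ)
  have h3 := cdf_gaussianReal_sub_le (x := x) (y := x + 3 * δ) (by linarith)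
  have h4 := cdf_gaussianReal_sub_le (x := x - 2 * δ) (y := x) (by linarith)
  have h5 : μ.real {ω | ∑ i, X i ω ≤ x} ≤ μ.real {ω | ∑ i, X i ω < x + 3 * δ - 2 * δ} :=
    measureReal_mono fun ω hω => by
      rw [Set.mem_ofPred_eq] at hω ⊢
      linarith
  have h6 : μ.real {ω | ∑ i, X i ω < x - 2 * δ + 2 * δ} ≤ μ.real {ω | ∑ i, X i ω ≤ x} :=
    measureReal_mono fun ω hω => by
      rw [Set.mem_ofPred_eq] at hω ⊢
      linarith
  rw [abs_le]
  constructor <;> linarith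

end BerryEsseen

/-! ### Mean and variance of the inversion number. -/

section Moments

theorem integral_uniformOn_Iic (m : ℕ) (g : ℕ → ℝ) :
    ∫ k, g k ∂(uniformOn (Set.Iic m)) = (∑ k ∈ Finset.range (m + 1), g k) / (m + 1) := by
  have hs : Set.Iic m = (Finset.range (m + 1) : Set ℕ) := by
    ext k
    simp
  have hint : IntegrableOn g (Finset.range (m + 1) : Set ℕ) Measure.count := by
    rw [← Set.biUnion_of_singleton (Finset.range (m + 1) : Set ℕ)]
    exact integrableOn_finset_iUnion.2 fun _ _ => by simp
  rw [uniformOn, ProbabilityTheory.cond, integral_smul_measure, hs,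
    setIntegral_finset _ hint, Measure.count_apply_finset]
  simp only [ENNReal.toReal_inv, ENNReal.toReal_natCast, Finset.card_range, measureReal_def,
    Measure.count_singleton, ENNReal.toReal_one, one_mul, smul_eq_mul]
  push_cast
  rw [div_eq_inv_mul]

theorem integral_inversionsEndingAt_comp {n : ℕ} (i : Fin n) (g : ℕ → ℝ) :
    ∫ π, g (inversionsEndingAt i π) ∂(uniformPerm n) =
      (∑ k ∈ Finset.range ((i : ℕ) + 1), g k) / ((i : ℕ) + 1) := by
  rw [← integral_uniformOn_Iic, ← (hasLaw_inversionsEndingAt i).map_eq,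
    integral_map (measurable_of_finite _).aemeasurable
      (measurable_of_countable g).aestronglyMeasurable]

theorem integral_inversionsEndingAt {n : ℕ} (i : Fin n) :
    ∫ π, (inversionsEndingAt i π : ℝ) ∂(uniformPerm n) = (i : ℕ) / 2 := by
  rw [integral_inversionsEndingAt_comp i fun k => (k : ℝ), div_eq_iff (by positivity)]
  induction (i : ℕ) with
  | zero => simp
  | succ m ih =>
    rw [Finset.sum_range_succ, ih]
    push_cast
    ring

theorem integral_sq_inversionsEndingAt_sub {n : ℕ} (i : Fin n) :
    ∫ π, ((inversionsEndingAt i π : ℝ) - (i : ℕ) / 2) ^ 2 ∂(uniformPerm n) =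
      ((i : ℕ) : ℝ) * ((i : ℕ) + 2) / 12 := by
  rw [integral_inversionsEndingAt_comp i fun k => ((k : ℝ) - (i : ℕ) / 2) ^ 2,
    div_eq_iff (by positivity)]
  -- The centre `c` is kept free because the intended value `i / 2` would move during the induction.
  have h : ∀ (m : ℕ) (c : ℝ), ∑ k ∈ Finset.range (m + 1), ((k : ℝ) - c) ^ 2 =
      m * (m + 1) * (2 * m + 1) / 6 - c * m * (m + 1) + (m + 1) * c ^ 2 := by
    intro m c
    induction m with
    | zero => simp
    | succ m ih =>
      rw [Finset.sum_range_succ, ih]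
      push_cast
      ring
  rw [h]
  ring

theorem sum_fin_half (n : ℕ) : ∑ i : Fin n, ((i : ℕ) : ℝ) / 2 = inversionMean n := by
  rw [Fin.sum_univ_eq_sum_range (fun i => (i : ℝ) / 2) n, inversionMean, Nat.cast_choose_two]
  induction n with
  | zero => simp
  | succ n ih =>
    rw [Finset.sum_range_succ, ih]
    push_cast
    ring

theorem sum_fin_variance (n : ℕ) :
    ∑ i : Fin n, ((i : ℕ) : ℝ) * ((i : ℕ) + 2) / 12 = inversionVariance n := by
  rw [Fin.sum_univ_eq_sum_range (fun i => (i : ℝ) * (i + 2) / 12) n, inversionVariance]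
  induction n with
  | zero => simp
  | succ n ih =>
    rw [Finset.sum_range_succ, ih]
    push_cast
    ring

theorem integral_inversionCount (n : ℕ) :
    ∫ π, (inversionCount π : ℝ) ∂(uniformPerm n) = inversionMean n := by
  simp only [inversionCount_eq_sum, Nat.cast_sum]
  rw [integral_finsetSum _ fun i _ => Integrable.of_finite, ← sum_fin_half]
  exact Finset.sum_congr rfl fun i _ => integral_inversionsEndingAt i

theorem variance_inversionCount (n : ℕ) :
    variance (fun π : Equiv.Perm (Fin n) => (inversionCount π : ℝ)) (uniformPerm n) =
      inversionVariance n := by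
  have hind : iIndepFun (fun (i : Fin n) π => (inversionsEndingAt i π : ℝ)) (uniformPerm n) :=
    (iIndepFun_inversionsEndingAt n).comp (fun _ k => (k : ℝ)) fun _ => measurable_of_countable _
  have h := IndepFun.variance_sum (μ := uniformPerm n) (s := Finset.univ)
    (X := fun (i : Fin n) π => (inversionsEndingAt i π : ℝ))
    (fun i _ => MemLp.of_discrete) (fun i _ j _ hij => hind.indepFun hij)
  have hfun : (fun π : Equiv.Perm (Fin n) => (inversionCount π : ℝ)) =
      ∑ i : Fin n, fun π => (inversionsEndingAt i π : ℝ) := by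
    ext π
    simp [inversionCount_eq_sum]
  rw [hfun, h, ← sum_fin_variance]
  refine Finset.sum_congr rfl fun i _ => ?_
  rw [variance_eq_integral (measurable_of_finite _).aemeasurable, integral_inversionsEndingAt,
    integral_sq_inversionsEndingAt_sub]

end Moments

/-! ### Normal approximation for inversions. -/

section NormalApproximation

theorem sq_le_inversionVariance {n : ℕ} (hn : 2 ≤ n) :
    (n * √(n : ℝ) / 10) ^ 2 ≤ inversionVariance n := by
  have h : (2 : ℝ) ≤ n := by exact_mod_cast hn
  rw [inversionVariance, div_pow, mul_pow, Real.sq_sqrt (by linarith)]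
  nlinarith [mul_nonneg (sub_nonneg.2 h) (sub_nonneg.2 h), mul_pos (by linarith : (0 : ℝ) < n)
    (by linarith : (0 : ℝ) < n), mul_nonneg (mul_nonneg (by linarith : (0 : ℝ) ≤ n)
    (by linarith : (0 : ℝ) ≤ n)) (sub_nonneg.2 h)]

theorem le_sqrt_inversionVariance {n : ℕ} (hn : 2 ≤ n) :
    n * √(n : ℝ) / 10 ≤ √(inversionVariance n) :=
  Real.le_sqrt_of_sq_le (sq_le_inversionVariance hn)

/-- Centred entries are at most n/2 in absolute value and σ_n ≥ n^(3/2)/10, so δ = 5/√n is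
admissible and 17 · 5 = 85. -/
theorem abs_standardizedInversions_sub_cdf_le {n : ℕ} (hn : 2 ≤ n) (x : ℝ) :
    |(uniformPerm n).real {π | standardizedInversions n π ≤ x} - cdf (gaussianReal 0 1) x| ≤
      85 / √(n : ℝ) := by
  have hn0 : (0 : ℝ) < n := by exact_mod_cast (by omega : 0 < n)
  have hsn : 0 < √(n : ℝ) := Real.sqrt_pos.2 hn0
  have hσ := le_sqrt_inversionVariance hn
  have hσ0 : 0 < √(inversionVariance n) := lt_of_lt_of_le (by positivity) hσ
  set σ := √(inversionVariance n) with hσdef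
  set X : Fin n → Equiv.Perm (Fin n) → ℝ := fun i π =>
    ((inversionsEndingAt i π : ℝ) - (i : ℕ) / 2) / σ with hX
  have hind : iIndepFun X (uniformPerm n) :=
    (iIndepFun_inversionsEndingAt n).comp (fun i k => ((k : ℝ) - (i : ℕ) / 2) / σ)
      fun _ => measurable_of_countable _
  have hsum : ∀ π, standardizedInversions n π = ∑ i, X i π := fun π => by
    simp only [hX]
    rw [standardizedInversions, inversionCount_eq_sum, ← sum_fin_half,
      ← Finset.sum_div Finset.univ _ σ, Finset.sum_sub_distrib, Nat.cast_sum]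
  have hbound : ∀ i π, |X i π| ≤ 5 / √(n : ℝ) := by
    intro i π
    have h1 : (inversionsEndingAt i π : ℝ) ≤ (i : ℕ) := by
      exact_mod_cast inversionsEndingAt_le i π
    have h2 : ((i : ℕ) : ℝ) ≤ n := by exact_mod_cast i.isLt.le
    have h3 : (0 : ℝ) ≤ inversionsEndingAt i π := Nat.cast_nonneg _
    have h4 : |(inversionsEndingAt i π : ℝ) - (i : ℕ) / 2| ≤ n / 2 := by
      rw [abs_le]
      constructor <;> linarith
    rw [hX, abs_div, abs_of_pos hσ0, div_le_div_iff₀ hσ0 hsn]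
    calc _ ≤ n / 2 * √(n : ℝ) := mul_le_mul_of_nonneg_right h4 hsn.le
      _ ≤ 5 * σ := by linarith
  have hmean : ∀ i, ∫ π, X i π ∂(uniformPerm n) = 0 := by
    intro i
    rw [hX, integral_div, integral_sub Integrable.of_finite Integrable.of_finite,
      integral_inversionsEndingAt]
    simp
  have hvar : ∑ i, ∫ π, X i π ^ 2 ∂(uniformPerm n) = 1 := by
    simp only [hX, div_pow, integral_div, integral_sq_inversionsEndingAt_sub]
    rw [← Finset.sum_div, sum_fin_variance, hσdef,
      Real.sq_sqrt ((sq_nonneg _).trans (sq_le_inversionVariance hn)), div_self]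
    exact (Real.sqrt_pos.1 hσ0).ne'
  simp only [hsum]
  refine (abs_measureReal_sum_le_sub_cdf_le hind (by positivity) hbound hmean hvar x).trans_eq ?_
  ring

/-- Pointwise convergence of distribution functions implies weak convergence. -/
theorem tendsto_probabilityMeasure_of_tendsto_cdf {ι : Type*} {l : Filter ι}
    [l.IsCountablyGenerated] {P : ι → ProbabilityMeasure ℝ} {Q : ProbabilityMeasure ℝ}
    (h : ∀ x, Tendsto (fun i => (P i : Measure ℝ).real (Set.Iic x)) l
      (nhds ((Q : Measure ℝ).real (Set.Iic x)))) :
    Tendsto P l (nhds Q) := by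
  have hIoc : ∀ (R : ProbabilityMeasure ℝ) (a b : ℝ), a ≤ b → (R : Measure ℝ).real (Set.Ioc a b) =
      (R : Measure ℝ).real (Set.Iic b) - (R : Measure ℝ).real (Set.Iic a) := fun R a b hab => by
    have hset : Set.Ioc a b = Set.Iic b \ Set.Iic a := by
      ext y
      simp [and_comm]
    rw [hset, measureReal_sdiff (Set.Iic_subset_Iic.2 hab) measurableSet_Iic]
  have hpi : IsPiSystem {s : Set ℝ | ∃ a b, a ≤ b ∧ s = Set.Ioc a b} := by
    rintro _ ⟨a, b, hab, rfl⟩ _ ⟨c, d, hcd, rfl⟩ hne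
    rw [Set.Ioc_inter_Ioc] at hne ⊢
    exact ⟨_, _, (Set.nonempty_Ioc.1 hne).le, rfl⟩
  -- Half-open intervals form a π-system that contains, inside any open set, a neighbourhood of each
  -- of its points; their masses are differences of distribution functions.
  refine hpi.tendsto_probabilityMeasure_of_tendsto_of_mem ?_ ?_ ?_
  · rintro _ ⟨a, b, -, rfl⟩
    exact measurableSet_Ioc
  · intro u hu x hx
    obtain ⟨ε, hε, hsub⟩ := Metric.isOpen_iff.1 hu x hx
    refine ⟨Set.Ioc (x - ε / 2) (x + ε / 2), ⟨_, _, by linarith, rfl⟩,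
      Ioc_mem_nhds (by linarith) (by linarith), fun y hy => hsub ?_⟩
    rw [Metric.mem_ball, Real.dist_eq, abs_lt]
    constructor <;> linarith [hy.1, hy.2]
  · rintro _ ⟨a, b, hab, rfl⟩
    rw [← NNReal.tendsto_coe]
    have := (h b).sub (h a)
    simp only [← hIoc _ a b hab] at this
    exact this

theorem tendstoInDistribution_standardizedInversions :
    TendstoInDistribution standardizedInversions atTop (id : ℝ → ℝ)
      uniformPerm (gaussianReal 0 1) := by
  have hmeas : ∀ n, Measurable (standardizedInversions n) := fun n => measurable_of_finite _
  refine ⟨fun n => (hmeas n).aemeasurable, aemeasurable_id,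
    tendsto_probabilityMeasure_of_tendsto_cdf fun x => ?_⟩
  have h0 : Tendsto (fun n : ℕ => 85 / √(n : ℝ)) atTop (nhds 0) :=
    (Real.tendsto_sqrt_atTop.comp tendsto_natCast_atTop_atTop).const_div_atTop 85
  simp only [ProbabilityMeasure.coe_mk, Measure.map_id, ← cdf_eq_real]
  rw [tendsto_iff_dist_tendsto_zero]
  refine squeeze_zero' (Eventually.of_forall fun _ => dist_nonneg) ?_ h0
  filter_upwards [eventually_ge_atTop 2] with n hn
  rw [Real.dist_eq, map_measureReal_apply (hmeas n) measurableSet_Iic]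
  exact abs_standardizedInversions_sub_cdf_le hn x

end NormalApproximation

theorem mainTheorem6 :
    -- `I_n` is a sum of `n` independent increments, the `i`-th uniform on `{0, …, i - 1}`
    -- (the index `i : Fin n` starts at `0`, so its range here is `{0, …, i}`)
    (∀ n : ℕ, ∃ J : Fin n → Equiv.Perm (Fin n) → ℕ,
      (∀ π : Equiv.Perm (Fin n), inversionCount π = ∑ i, J i π) ∧
      iIndepFun J (uniformPerm n) ∧
      ∀ i : Fin n, HasLaw (J i) (uniformOn (Set.Iic (i : ℕ))) (uniformPerm n)) ∧
    -- mean and variance of `I_n`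
    (∀ n : ℕ,
      ∫ π, (inversionCount π : ℝ) ∂(uniformPerm n) = inversionMean n ∧
      variance (fun π : Equiv.Perm (Fin n) => (inversionCount π : ℝ)) (uniformPerm n) =
        inversionVariance n) ∧
    -- asymptotic normality
    TendstoInDistribution standardizedInversions atTop (id : ℝ → ℝ)
      uniformPerm (gaussianReal 0 1) ∧
    -- error term of order `n ^ (-1/2)`, uniformly over the real line
    (∃ C : ℝ, ∀ n : ℕ, 2 ≤ n → ∀ x : ℝ,
      |(uniformPerm n).real {π | standardizedInversions n π ≤ x} - cdf (gaussianReal 0 1) x|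
        ≤ C / √(n : ℝ)) :=
  ⟨fun n => ⟨inversionsEndingAt, inversionCount_eq_sum, iIndepFun_inversionsEndingAt n,
      hasLaw_inversionsEndingAt⟩,
    fun n => ⟨integral_inversionCount n, variance_inversionCount n⟩,
    tendstoInDistribution_standardizedInversions,
    85, fun _ hn x => abs_standardizedInversions_sub_cdf_le hn x⟩
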